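/- Let $d\in\mathbb N$ and let $\nu$ be a compactly supported Borel probability measure on $\mathbb R^d$ (with the Euclidean norm $|\cdot|$). For $n\in\mathbb N$ let $\mathcal F_n$ be the set of Borel measurable maps $f:\mathbb R^d\to\mathbb R^d$ whose image has at most $n$ elements, and for $r>0$ let $$\mathfrak e_{n,r}(\nu)=\inf_{f\in\mathcal F_n}\Big(\int |x-f(x)|^r\,d\nu(x)\Big)^{1/r},\qquad \overline D_r(\nu)=\limsup_{n\to\infty}\frac{\log n}{-\log \mathfrak e_{n,r}(\nu)}$$ (the quotient being $0$ when $\mathfrak e_{n,r}(\nu)=0$). Then $\overline D_r(\nu)$ is finite for every $r>0$, and the map $r\mapsto\overline D_r(\nu)$ is continuous on $(0,\infty)$. -/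

import Mathlib

open MeasureTheory Filter Set
open scoped ENNReal Topology

noncomputable section

/-- The set of `n`-quantizers of `ℝ^d`: Borel measurable maps `f : ℝ^d → ℝ^d`
whose image has at most `n` elements. -/
def quantizers (d n : ℕ) : Set (EuclideanSpace ℝ (Fin d) → EuclideanSpace ℝ (Fin d)) :=
  {f | Measurable f ∧ (Set.range f).encard ≤ n}

/-- The `n`-th quantization error of `ν` of order `r > 0`,
`inf_{f ∈ F_n} (∫ |x - f x|^r dν(x))^(1/r)`, with the Euclidean norm and as a value in `[0, ∞]`. -/
def quantizationError {d : ℕ} (ν : Measure (EuclideanSpace ℝ (Fin d))) (n : ℕ) (r : ℝ) : ℝ≥0∞ :=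
  ⨅ f ∈ quantizers d n, (∫⁻ x, ‖x - f x‖ₑ ^ r ∂ν) ^ (1 / r)

/-- The upper quantization dimension of `ν` of order `r`,
`limsup_{n → ∞} log n / (-log e_{n,r}(ν))`, in the extended reals. Here `log 0 = -∞`
and `a / ∞ = 0` for real `a`, so the quotient is `0` when the error vanishes. -/
def upperQuantizationDim {d : ℕ} (ν : Measure (EuclideanSpace ℝ (Fin d))) (r : ℝ) : EReal :=
  limsup (fun n : ℕ => ((Real.log n : ℝ) : EReal) / (-ENNReal.log (quantizationError ν n r))) atTop

end

/-! ### Quantization errors and the quotients whose limsup is the dimension. -/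

section QuantizationError

variable {d : ℕ} {ν : Measure (EuclideanSpace ℝ (Fin d))}

/-! For `0 < r ≤ s` the dimensions satisfy `D_r ≤ D_s ≤ (s / r) * D_r`; with finiteness, this
squeezes `D_s` to `D_r` as `s → r` from either side.

The left inequality is monotonicity of `L^r` norms for a probability measure. For the right one, a
quantizer can be truncated so that its error is at most `3 * R` on the support; then `e_s ^ s ≤ (3R)
^ (s - r) * e_r ^ r` (`quantizationError_rpow_le`). After logarithms the constant is negligible
because `-log e → ∞`.

Grid quantizers make the errors decay at least like a power of `n`, which gives both that divergence
and finiteness (`eventually_quantizationError_le`). -/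

theorem quantizationError_mono_order [IsProbabilityMeasure ν] (n : ℕ) {r s : ℝ} (hr : 0 < r)
    (hrs : r ≤ s) : quantizationError ν n r ≤ quantizationError ν n s := by
  refine iInf₂_mono fun f hf => ?_
  have hm : AEStronglyMeasurable (fun x => x - f x) ν :=
    (measurable_id.sub hf.1).aestronglyMeasurable
  simpa [eLpNorm'] using eLpNorm'_le_eLpNorm'_of_exponent_le hr hrs ν hm

/-- Quantizer values far away from the support may be moved to the origin, after which the
pointwise error is bounded by `3 * R`. -/
theorem exists_quantizer_norm_le_three_mul {n : ℕ}
    {f : EuclideanSpace ℝ (Fin d) → EuclideanSpace ℝ (Fin d)}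
    (hf : f ∈ quantizers d n) (R : ℝ) :
    ∃ g ∈ quantizers d n, ∀ x, ‖x‖ ≤ R → ‖x - g x‖ ≤ ‖x - f x‖ ∧ ‖x - g x‖ ≤ 3 * R := by
  let h : EuclideanSpace ℝ (Fin d) → EuclideanSpace ℝ (Fin d) :=
    fun y => if ‖y‖ ≤ 2 * R then y else 0
  have hh : Measurable h :=
    Measurable.ite (measurableSet_le measurable_norm measurable_const) measurable_id
      measurable_const
  refine ⟨h ∘ f, ⟨hh.comp hf.1, ?_⟩, fun x hx => ?_⟩
  · rw [Set.range_comp]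
    exact (Set.encard_image_le _ _).trans hf.2
  · simp only [Function.comp, h]
    -- If `‖f x‖ > 2 * R`, then `‖x - f x‖ > R ≥ ‖x‖`, so the origin is no worse a value.
    split_ifs with hy
    · have := norm_sub_le x (f x)
      exact ⟨le_rfl, by linarith⟩
    · have h1 := norm_sub_norm_le (f x) x
      rw [norm_sub_rev] at h1
      have h0 := norm_nonneg x
      rw [sub_zero]
      push Not at hy
      constructor <;> linarith

theorem quantizationError_rpow_le {R : ℝ} (hR : 0 < R) (hν : ∀ᵐ x ∂ν, ‖x‖ ≤ R) (n : ℕ) {r s : ℝ}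
    (hr : 0 < r) (hrs : r ≤ s) :
    quantizationError ν n s ^ s ≤
      ENNReal.ofReal (3 * R) ^ (s - r) * quantizationError ν n r ^ r := by
  have hs : 0 < s := hr.trans_le hrs
  set c := ENNReal.ofReal (3 * R) ^ (s - r)
  have hc0 : c ≠ 0 := (ENNReal.rpow_pos (by simpa using hR) ENNReal.ofReal_ne_top).ne'
  have hct : c ≠ ⊤ := ENNReal.rpow_ne_top_of_nonneg (by linarith) ENNReal.ofReal_ne_top
  -- With `e_{n,r}` alone on the right, the bound can be checked for each `f` in its infimum.
  have key : (quantizationError ν n s ^ s / c) ^ (1 / r) ≤ quantizationError ν n r := by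
    refine le_iInf₂ fun f hf => ENNReal.rpow_le_rpow ?_ (by positivity)
    obtain ⟨g, hg, hgx⟩ := exists_quantizer_norm_le_three_mul hf R
    rw [ENNReal.div_le_iff hc0 hct]
    calc quantizationError ν n s ^ s
        ≤ ((∫⁻ x, ‖x - g x‖ₑ ^ s ∂ν) ^ (1 / s)) ^ s :=
          ENNReal.rpow_le_rpow (iInf₂_le g hg) hs.le
      _ = ∫⁻ x, ‖x - g x‖ₑ ^ s ∂ν := by
          rw [← ENNReal.rpow_mul, one_div_mul_cancel hs.ne', ENNReal.rpow_one]
      _ ≤ ∫⁻ x, ‖x - f x‖ₑ ^ r * c ∂ν := by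
          refine lintegral_mono_ae (hν.mono fun x hx => ?_)
          obtain ⟨h1, h2⟩ := hgx x hx
          have h1' : ‖x - g x‖ₑ ≤ ‖x - f x‖ₑ := by
            rw [← ofReal_norm, ← ofReal_norm]
            exact ENNReal.ofReal_le_ofReal h1
          have h2' : ‖x - g x‖ₑ ≤ ENNReal.ofReal (3 * R) := by
            rw [← ofReal_norm]
            exact ENNReal.ofReal_le_ofReal h2
          calc ‖x - g x‖ₑ ^ s = ‖x - g x‖ₑ ^ r * ‖x - g x‖ₑ ^ (s - r) := by
                rw [← ENNReal.rpow_add_of_nonneg _ _ hr.le (by linarith)]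
                congr 1
                ring
            _ ≤ _ := mul_le_mul' (ENNReal.rpow_le_rpow h1' hr.le)
                (ENNReal.rpow_le_rpow h2' (by linarith))
      _ = (∫⁻ x, ‖x - f x‖ₑ ^ r ∂ν) * c := lintegral_mul_const' _ _ hct
  have := ENNReal.rpow_le_rpow key hr.le
  rw [← ENNReal.rpow_mul, one_div_mul_cancel hr.ne', ENNReal.rpow_one,
    ENNReal.div_le_iff hc0 hct] at this
  rwa [mul_comm]

/-- Rounding to the grid `m⁻¹ ℤ^d` inside a ball of radius `R` is an `n`-quantizer when
`(2mR+1)^d ≤ n`. -/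
theorem exists_quantizer_norm_sub_le (d : ℕ) (R m n : ℕ) (hm : 0 < m)
    (hn : (2 * m * R + 1) ^ d ≤ n) :
    ∃ f ∈ quantizers d n, ∀ x, ‖x‖ ≤ R → ‖x - f x‖ ≤ (d + 1) / m := by
  have hm' : (0 : ℝ) < m := by exact_mod_cast hm
  let p : (Fin d → ℤ) → EuclideanSpace ℝ (Fin d) := fun z => WithLp.toLp 2 fun i => (z i : ℝ) / m
  let q : EuclideanSpace ℝ (Fin d) → (Fin d → ℤ) := fun x =>
    if ‖x‖ ≤ R then fun i => ⌊m * x i⌋ else 0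
  have hq : Measurable q := by
    refine Measurable.ite (measurableSet_le measurable_norm measurable_const) ?_ measurable_const
    refine measurable_pi_lambda _ fun i => Int.measurable_floor.comp ?_
    fun_prop
  have hp : Measurable p := measurable_of_countable p
  have hrange : Set.range q ⊆
      (Fintype.piFinset fun _ : Fin d => Finset.Icc (-(m * R : ℤ)) (m * R) : Finset _) := by
    rintro _ ⟨x, rfl⟩
    rw [Finset.mem_coe, Fintype.mem_piFinset]
    intro i
    simp only [q]
    split_ifs with hx
    · have h1 : |x i| ≤ R := by
        simpa using (PiLp.norm_apply_le x i).trans hx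
      obtain ⟨h2, h3⟩ := abs_le.1 h1
      rw [Finset.mem_Icc]
      constructor
      · rw [Int.le_floor]
        push_cast
        nlinarith
      · rw [← Int.cast_le (R := ℝ)]
        refine (Int.floor_le _).trans ?_
        push_cast
        nlinarith
    · simp only [Pi.zero_apply, Finset.mem_Icc]
      have : (0 : ℤ) ≤ m * R := by positivity
      exact ⟨neg_nonpos.2 this, this⟩
  refine ⟨p ∘ q, ⟨hp.comp hq, ?_⟩, fun x hx => ?_⟩
  · rw [Set.range_comp]
    refine (Set.encard_image_le _ _).trans ((Set.encard_le_encard hrange).trans ?_)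
    rw [Set.encard_coe_eq_coe_finsetCard, Fintype.card_piFinset_const, Int.card_Icc]
    have : ((m * R : ℤ) + 1 - -(m * R : ℤ)).toNat = 2 * m * R + 1 := by
      have : ((m * R : ℤ) + 1 - -(m * R : ℤ)) = ((2 * m * R + 1 : ℕ) : ℤ) := by push_cast; ring
      rw [this, Int.toNat_natCast]
    rw [this]
    exact_mod_cast hn
  · have hi : ∀ i, ‖(x - (p ∘ q) x) i‖ ≤ 1 / m := by
      intro i
      have : (x - (p ∘ q) x) i = (m * x i - ⌊m * x i⌋) / m := by
        simp only [Function.comp, PiLp.sub_apply, p, q, if_pos hx]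
        field_simp
      rw [this, norm_div, Real.norm_natCast, Int.self_sub_floor, Real.norm_eq_abs,
        abs_of_nonneg (Int.fract_nonneg _)]
      gcongr
      exact (Int.fract_lt_one _).le
    rw [EuclideanSpace.norm_eq]
    refine Real.sqrt_le_iff.2 ⟨by positivity, ?_⟩
    calc ∑ i, ‖(x - (p ∘ q) x) i‖ ^ 2 ≤ ∑ _i : Fin d, (1 / (m : ℝ)) ^ 2 := by
          gcongr with i
          exact hi i
      _ = d * (1 / (m : ℝ)) ^ 2 := by simp
      _ ≤ (d + 1) ^ 2 * (1 / (m : ℝ)) ^ 2 := by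
          gcongr
          nlinarith [(Nat.cast_nonneg d : (0 : ℝ) ≤ d)]
      _ = ((d + 1) / m) ^ 2 := by ring

theorem quantizationError_le_of_norm_sub_le [IsProbabilityMeasure ν] {n : ℕ} {r ε : ℝ} (hr : 0 < r)
    {f : EuclideanSpace ℝ (Fin d) → EuclideanSpace ℝ (Fin d)} (hf : f ∈ quantizers d n)
    (h : ∀ᵐ x ∂ν, ‖x - f x‖ ≤ ε) : quantizationError ν n r ≤ ENNReal.ofReal ε := by
  refine (iInf₂_le f hf).trans ?_
  calc (∫⁻ x, ‖x - f x‖ₑ ^ r ∂ν) ^ (1 / r)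
      ≤ (∫⁻ _, ENNReal.ofReal ε ^ r ∂ν) ^ (1 / r) := by
        refine ENNReal.rpow_le_rpow (lintegral_mono_ae (h.mono fun x hx => ?_)) (by positivity)
        refine ENNReal.rpow_le_rpow ?_ hr.le
        rw [← ofReal_norm]
        exact ENNReal.ofReal_le_ofReal hx
    _ = ENNReal.ofReal ε := by
        rw [lintegral_const, measure_univ, mul_one, ← ENNReal.rpow_mul, mul_one_div_cancel hr.ne',
          ENNReal.rpow_one]

/-- Take the grid of mesh `1 / m` with `m = ⌊n ^ (1 / k)⌋` and `k = 2 * d + 1`. For `m ≥ 2 * R + 1`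
it needs at most `m ^ (2 * d) ≤ n` points. The factor `4` is `2 * 2`: `n ≤ m ^ (2 * k)` since `m + 1
≤ m ^ 2`, and `(d + 1) / m ≤ m ^ (-1 / 2)` since `(d + 1) ^ 2 ≤ m`. A sharp rate is not needed. -/
theorem eventually_quantizationError_le [IsProbabilityMeasure ν] {R : ℕ}
    (hν : ∀ᵐ x ∂ν, ‖x‖ ≤ R) {r : ℝ} (hr : 0 < r) :
    ∀ᶠ n : ℕ in atTop, quantizationError ν n r ≠ ⊤ ∧ (quantizationError ν n r ≠ 0 →
      Real.log n ≤ 4 * (2 * d + 1) * -Real.log (quantizationError ν n r).toReal) := by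
  set k : ℕ := 2 * d + 1 with hk
  have htend : Tendsto (fun n : ℕ => ⌊(n : ℝ) ^ (1 / (k : ℝ))⌋₊) atTop atTop :=
    tendsto_nat_floor_atTop.comp
      ((tendsto_rpow_atTop (by positivity)).comp tendsto_natCast_atTop_atTop)
  filter_upwards [htend.eventually_ge_atTop (2 * R + 1), htend.eventually_ge_atTop ((d + 1) ^ 2),
    htend.eventually_ge_atTop 2, eventually_ge_atTop 1] with n h1 h2 h3 hn
  set m := ⌊(n : ℝ) ^ (1 / (k : ℝ))⌋₊ with hm
  have hn0 : (0 : ℝ) ≤ (n : ℝ) := n.cast_nonneg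
  have hroot : ((n : ℝ) ^ (1 / (k : ℝ))) ^ k = n := by
    rw [one_div]
    exact Real.rpow_inv_natCast_pow hn0 (by omega)
  have hmn : m ^ k ≤ n := by
    have : (m : ℝ) ^ k ≤ n := by
      rw [← hroot]
      exact pow_le_pow_left₀ (by positivity) (Nat.floor_le (by positivity)) _
    exact_mod_cast this
  have hnm : (n : ℝ) ≤ ((m : ℝ) ^ 2) ^ k := by
    rw [← hroot]
    refine pow_le_pow_left₀ (by positivity) ((Nat.lt_floor_add_one _).le.trans ?_) _
    have : (2 : ℝ) ≤ m := by exact_mod_cast h3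
    nlinarith
  have hcount : (2 * m * R + 1) ^ d ≤ n := by
    calc (2 * m * R + 1) ^ d ≤ (m ^ 2) ^ d := Nat.pow_le_pow_left (by nlinarith) _
      _ = m ^ (2 * d) := (pow_mul _ _ _).symm
      _ ≤ m ^ k := Nat.pow_le_pow_right (by omega) (by omega)
      _ ≤ n := hmn
  obtain ⟨f, hf, hfx⟩ := exists_quantizer_norm_sub_le d R m n (by omega) hcount
  have hle := quantizationError_le_of_norm_sub_le (ν := ν) hr hf (hν.mono hfx)
  have htop : quantizationError ν n r ≠ ⊤ := (hle.trans_lt ENNReal.ofReal_lt_top).ne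
  refine ⟨htop, fun h0 => ?_⟩
  have hm0 : (0 : ℝ) < m := by exact_mod_cast (by omega : 0 < m)
  have hpos := ENNReal.toReal_pos h0 htop
  have he : (quantizationError ν n r).toReal ≤ (d + 1) / m :=
    ENNReal.toReal_le_of_le_ofReal (by positivity) hle
  have hlog := Real.log_le_log hpos he
  rw [Real.log_div (by positivity) hm0.ne'] at hlog
  have hd : 2 * Real.log (d + 1) ≤ Real.log m := by
    have : ((d : ℝ) + 1) ^ 2 ≤ m := by exact_mod_cast h2
    simpa [Real.log_pow] using Real.log_le_log (by positivity) this
  have hln : Real.log n ≤ k * (2 * Real.log m) := by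
    have := Real.log_le_log (by exact_mod_cast hn) hnm
    simpa [Real.log_pow] using this
  have hkR : (k : ℝ) = 2 * d + 1 := by simp [hk]
  rw [← hkR]
  have : (k : ℝ) * (2 * Real.log m) ≤ k * (4 * -Real.log (quantizationError ν n r).toReal) :=
    mul_le_mul_of_nonneg_left (by linarith) k.cast_nonneg
  linarith

/-- The real quotient `log n / -log e_{n,r}`, which is `0` when the error vanishes. -/
noncomputable def quantizationQuotient (ν : Measure (EuclideanSpace ℝ (Fin d)))
    (r : ℝ) (n : ℕ) : ℝ :=
  Real.log n / -Real.log (quantizationError ν n r).toReal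

/-- At `e = 0` both conventions give `0`: `a / ⊤` in `EReal`, and `a / 0` in `ℝ` because `Real.log 0
= 0`. -/
theorem log_div_neg_log_eq_coe {e : ℝ≥0∞} (he : e ≠ ⊤) (a : ℝ) :
    (a : EReal) / (-ENNReal.log e) = ((a / -Real.log e.toReal : ℝ) : EReal) := by
  rcases eq_or_ne e 0 with rfl | h0
  · simp
  · rw [ENNReal.log_pos_real h0 he]
    norm_cast

theorem upperQuantizationDim_eq_limsup [IsProbabilityMeasure ν] {R : ℕ}
    (hν : ∀ᵐ x ∂ν, ‖x‖ ≤ R) {r : ℝ} (hr : 0 < r) :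
    upperQuantizationDim ν r =
      limsup (fun n : ℕ => (quantizationQuotient ν r n : EReal)) atTop := by
  refine limsup_congr ?_
  filter_upwards [eventually_quantizationError_le hν hr] with n hn
  exact log_div_neg_log_eq_coe hn.1 _

theorem eventually_quantizationQuotient_mem_Icc [IsProbabilityMeasure ν] {R : ℕ}
    (hν : ∀ᵐ x ∂ν, ‖x‖ ≤ R) {r : ℝ} (hr : 0 < r) :
    ∀ᶠ n : ℕ in atTop, quantizationQuotient ν r n ∈ Set.Icc 0 (4 * (2 * d + 1) : ℝ) := by
  filter_upwards [eventually_quantizationError_le hν hr, eventually_gt_atTop 1] with n hn h1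
  unfold quantizationQuotient
  rcases eq_or_ne (quantizationError ν n r) 0 with h0 | h0
  · simp only [h0, ENNReal.toReal_zero, Real.log_zero, neg_zero, div_zero, Set.mem_Icc, le_refl,
      true_and]
    positivity
  · have hlog : 0 < Real.log n := Real.log_pos (by exact_mod_cast h1)
    have h := hn.2 h0
    have hL : 0 < -Real.log (quantizationError ν n r).toReal :=
      pos_of_mul_pos_right (hlog.trans_le h) (by positivity)
    exact ⟨by positivity, (div_le_iff₀ hL).2 h⟩

/-- The errors tend to zero, stated through their logarithms. -/
theorem eventually_le_neg_log_quantizationError [IsProbabilityMeasure ν] {R : ℕ}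
    (hν : ∀ᵐ x ∂ν, ‖x‖ ≤ R) {r : ℝ} (hr : 0 < r) (C : ℝ) :
    ∀ᶠ n : ℕ in atTop, quantizationError ν n r ≠ 0 →
      C ≤ -Real.log (quantizationError ν n r).toReal := by
  have ht : Tendsto (fun n : ℕ => Real.log n) atTop atTop :=
    Real.tendsto_log_atTop.comp tendsto_natCast_atTop_atTop
  filter_upwards [eventually_quantizationError_le hν hr,
    ht.eventually_ge_atTop (4 * (2 * d + 1) * C)] with n hn h1 h0
  exact le_of_mul_le_mul_left (h1.trans (hn.2 h0)) (by positivity)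

theorem eventually_quantizationQuotient_mono [IsProbabilityMeasure ν] {R : ℕ}
    (hν : ∀ᵐ x ∂ν, ‖x‖ ≤ R) {r s : ℝ} (hr : 0 < r) (hrs : r ≤ s) :
    ∀ᶠ n : ℕ in atTop, quantizationQuotient ν r n ≤ quantizationQuotient ν s n := by
  have hs := hr.trans_le hrs
  filter_upwards [eventually_quantizationError_le hν hs,
    eventually_quantizationQuotient_mem_Icc hν hs,
    eventually_le_neg_log_quantizationError hν hs 1] with n hn h1 h2
  have hle := quantizationError_mono_order (ν := ν) n hr hrs
  rcases eq_or_ne (quantizationError ν n r) 0 with h0 | h0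
  · refine le_trans (le_of_eq ?_) h1.1
    simp [quantizationQuotient, h0]
  · have h0' : quantizationError ν n s ≠ 0 := fun h => h0 (le_zero_iff.1 (h ▸ hle))
    have hL := h2 h0'
    have hpos := ENNReal.toReal_pos h0 (ne_top_of_le_ne_top hn.1 hle)
    unfold quantizationQuotient
    have := Real.log_natCast_nonneg n
    have htop := hn.1
    gcongr

/-- The strict gap `s / r < t` leaves room to absorb the additive constant `(s - r) * log M`. -/
theorem eventually_quantizationQuotient_le_mul [IsProbabilityMeasure ν] {R : ℕ}
    (hν : ∀ᵐ x ∂ν, ‖x‖ ≤ R) {r s t : ℝ} (hr : 0 < r) (hrs : r ≤ s) (ht : s / r < t) :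
    ∀ᶠ n : ℕ in atTop, quantizationQuotient ν s n ≤ t * quantizationQuotient ν r n := by
  have hs := hr.trans_le hrs
  have hts : s < t * r := (div_lt_iff₀ hr).1 ht
  have ht0 : 0 < t := (div_pos hs hr).trans ht
  -- Enlarging the radius to `R + 1` keeps it positive when `R = 0`.
  set M : ℝ := 3 * (R + 1) with hM
  have hM0 : 0 < M := by positivity
  have hν' : ∀ᵐ x ∂ν, ‖x‖ ≤ (R : ℝ) + 1 := hν.mono fun x hx => by linarith
  filter_upwards [eventually_quantizationError_le hν hs, eventually_quantizationError_le hν hr,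
    eventually_quantizationQuotient_mem_Icc hν hr,
    eventually_le_neg_log_quantizationError hν hs 1,
    eventually_le_neg_log_quantizationError hν hr 1,
    eventually_le_neg_log_quantizationError hν hr (t * ((s - r) * Real.log M) / (t * r - s))]
    with n hns hnr h1 hLs h1r hLr
  rcases eq_or_ne (quantizationError ν n s) 0 with h0 | h0
  · refine le_trans (le_of_eq ?_) (mul_nonneg ht0.le h1.1)
    simp [quantizationQuotient, h0]
  have hle := quantizationError_rpow_le (by positivity) hν' n hr hrs
  have h0' : quantizationError ν n r ≠ 0 := by
    intro h
    rw [h, ENNReal.zero_rpow_of_pos hr, mul_zero, le_zero_iff, ENNReal.rpow_eq_zero_iff_of_pos hs]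
      at hle
    exact h0 hle
  have hps := ENNReal.toReal_pos h0 hns.1
  have hpr := ENNReal.toReal_pos h0' hnr.1
  have hle' := ENNReal.toReal_mono (ENNReal.mul_ne_top
    (ENNReal.rpow_ne_top_of_nonneg (by linarith) ENNReal.ofReal_ne_top)
    (ENNReal.rpow_ne_top_of_nonneg hr.le hnr.1)) hle
  rw [ENNReal.toReal_mul, ← ENNReal.toReal_rpow, ← ENNReal.toReal_rpow, ← ENNReal.toReal_rpow,
    ENNReal.toReal_ofReal hM0.le] at hle'
  have hlog := Real.log_le_log (by positivity) hle'
  rw [Real.log_mul (by positivity) (by positivity), Real.log_rpow hps, Real.log_rpow hM0,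
    Real.log_rpow hpr] at hlog
  have hLs := hLs h0
  have hLr := hLr h0'
  have hlr := h1r h0'
  rw [div_le_iff₀ (by linarith)] at hLr
  unfold quantizationQuotient
  set ls := Real.log (quantizationError ν n s).toReal
  set lr := Real.log (quantizationError ν n r).toReal
  -- The threshold in `hLr` is exactly `(t * r - s) * -lr ≥ t * (s - r) * log M`.
  have hcomp : -lr ≤ t * -ls := by
    have : t * (s * ls) ≤ t * ((s - r) * Real.log M + r * lr) := by gcongr
    nlinarith
  rw [← mul_div_assoc, div_le_div_iff₀ (by linarith) (by linarith)]
  calc Real.log n * -lr ≤ Real.log n * (t * -ls) :=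
        mul_le_mul_of_nonneg_left hcomp (Real.log_natCast_nonneg n)
    _ = t * Real.log n * -ls := by ring

end QuantizationError

/-! ### Finiteness, comparison and continuity of the dimension. -/

section Dimension

variable {d : ℕ} {ν : Measure (EuclideanSpace ℝ (Fin d))} [IsProbabilityMeasure ν] {R : ℕ}

theorem upperQuantizationDim_mem_Icc (hν : ∀ᵐ x ∂ν, ‖x‖ ≤ R) {r : ℝ} (hr : 0 < r) :
    upperQuantizationDim ν r ∈ Set.Icc 0 ((4 * (2 * d + 1) : ℝ) : EReal) := by
  rw [upperQuantizationDim_eq_limsup hν hr]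
  have h := eventually_quantizationQuotient_mem_Icc hν hr
  constructor
  · exact le_limsup_of_frequently_le (h.mono fun n hn => by exact_mod_cast hn.1).frequently
  · exact limsup_le_of_le (h := h.mono fun n hn => by exact_mod_cast hn.2)

theorem coe_toReal_upperQuantizationDim (hν : ∀ᵐ x ∂ν, ‖x‖ ≤ R) {r : ℝ} (hr : 0 < r) :
    ((upperQuantizationDim ν r).toReal : EReal) = upperQuantizationDim ν r := by
  have h := upperQuantizationDim_mem_Icc hν hr
  exact EReal.coe_toReal (ne_top_of_le_ne_top (EReal.coe_ne_top _) h.2)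
    (ne_bot_of_le_ne_bot (by simp) h.1)

theorem upperQuantizationDim_toReal_mono (hν : ∀ᵐ x ∂ν, ‖x‖ ≤ R) {r s : ℝ} (hr : 0 < r)
    (hrs : r ≤ s) :
    (upperQuantizationDim ν r).toReal ≤ (upperQuantizationDim ν s).toReal := by
  have hs := hr.trans_le hrs
  rw [← EReal.coe_le_coe_iff, coe_toReal_upperQuantizationDim hν hr,
    coe_toReal_upperQuantizationDim hν hs, upperQuantizationDim_eq_limsup hν hr,
    upperQuantizationDim_eq_limsup hν hs]
  exact limsup_le_limsup ((eventually_quantizationQuotient_mono hν hr hrs).mono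
    fun n hn => EReal.coe_le_coe_iff.2 hn)

theorem upperQuantizationDim_toReal_le_mul (hν : ∀ᵐ x ∂ν, ‖x‖ ≤ R) {r s : ℝ} (hr : 0 < r)
    (hrs : r ≤ s) :
    (upperQuantizationDim ν s).toReal ≤ s / r * (upperQuantizationDim ν r).toReal := by
  have hs := hr.trans_le hrs
  -- Both factors are given slack, removed afterwards by letting `c ↓ D_r` and then `t ↓ s / r`.
  have key : ∀ t, s / r < t → ∀ c, (upperQuantizationDim ν r).toReal < c →
      (upperQuantizationDim ν s).toReal ≤ t * c := by
    intro t ht c hc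
    have ht0 : 0 < t := (div_pos hs hr).trans ht
    rw [← EReal.coe_le_coe_iff, coe_toReal_upperQuantizationDim hν hs,
      upperQuantizationDim_eq_limsup hν hs]
    rw [← EReal.coe_lt_coe_iff, coe_toReal_upperQuantizationDim hν hr,
      upperQuantizationDim_eq_limsup hν hr] at hc
    refine limsup_le_of_le (h := ?_)
    filter_upwards [eventually_lt_of_limsup_lt hc,
      eventually_quantizationQuotient_le_mul hν hr hrs ht] with n h1 h2
    have h1 : quantizationQuotient ν r n < c := by exact_mod_cast h1
    exact_mod_cast h2.trans (by gcongr)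
  have h1 : ∀ t, s / r < t →
      (upperQuantizationDim ν s).toReal ≤ t * (upperQuantizationDim ν r).toReal := by
    intro t ht
    refine ge_of_tendsto (f := fun c => t * c) (x := 𝓝[>] (upperQuantizationDim ν r).toReal)
      ((continuous_const.mul continuous_id).continuousWithinAt) ?_
    exact eventually_nhdsWithin_of_forall fun c hc => key t ht c hc
  refine ge_of_tendsto (f := fun t => t * (upperQuantizationDim ν r).toReal) (x := 𝓝[>] (s / r))
    ((continuous_id.mul continuous_const).continuousWithinAt) ?_
  exact eventually_nhdsWithin_of_forall h1

theorem continuousOn_upperQuantizationDim (hν : ∀ᵐ x ∂ν, ‖x‖ ≤ R) :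
    ContinuousOn (fun r : ℝ => upperQuantizationDim ν r) (Set.Ioi 0) := by
  set D : ℝ → ℝ := fun r => (upperQuantizationDim ν r).toReal with hD
  suffices h : ContinuousOn D (Set.Ioi 0) from
    (continuous_coe_real_ereal.comp_continuousOn h).congr fun r hr =>
      (coe_toReal_upperQuantizationDim hν hr).symm
  intro r hr
  rw [Set.mem_Ioi] at hr
  -- Since `D s` lies between `D r` and `s / r * D r` whichever of `r`, `s` is larger, `min` and
  -- `max` treat both sides of `r` at once.
  have hlow : Tendsto (fun s => min (D r) (s / r * D r)) (𝓝[Set.Ioi 0] r) (𝓝 (D r)) := by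
    have : Continuous fun s => min (D r) (s / r * D r) := by fun_prop
    simpa [div_self hr.ne'] using (this.tendsto r).mono_left nhdsWithin_le_nhds
  have hupp : Tendsto (fun s => max (D r) (s / r * D r)) (𝓝[Set.Ioi 0] r) (𝓝 (D r)) := by
    have : Continuous fun s => max (D r) (s / r * D r) := by fun_prop
    simpa [div_self hr.ne'] using (this.tendsto r).mono_left nhdsWithin_le_nhds
  refine tendsto_of_tendsto_of_tendsto_of_le_of_le' hlow hupp ?_ ?_ <;>
    filter_upwards [self_mem_nhdsWithin] with s hs <;> rw [Set.mem_Ioi] at hs <;>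
    rcases le_total r s with h | h
  · exact (min_le_left _ _).trans (upperQuantizationDim_toReal_mono hν hr h)
  · refine (min_le_right _ _).trans ?_
    have := upperQuantizationDim_toReal_le_mul hν hs h
    calc s / r * D r ≤ s / r * (r / s * D s) := by gcongr
      _ = D s := by field_simp
  · exact (upperQuantizationDim_toReal_le_mul hν hr h).trans (le_max_right _ _)
  · exact (upperQuantizationDim_toReal_mono hν hs h).trans (le_max_left _ _)

end Dimension

theorem corollary1p4 (d : ℕ) (ν : Measure (EuclideanSpace ℝ (Fin d))) [IsProbabilityMeasure ν]
    (hν : IsCompact ν.support) :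
    (∀ r : ℝ, 0 < r → upperQuantizationDim ν r ≠ ⊥ ∧ upperQuantizationDim ν r ≠ ⊤) ∧
      ContinuousOn (fun r : ℝ => upperQuantizationDim ν r) (Set.Ioi 0) := by
  obtain ⟨C, hC⟩ := hν.isBounded.exists_norm_le
  obtain ⟨R, hR⟩ := exists_nat_ge C
  have hb : ∀ᵐ x ∂ν, ‖x‖ ≤ R := by
    filter_upwards [Measure.support_mem_ae] with x hx
    exact (hC x hx).trans hR
  refine ⟨fun r hr => ?_, continuousOn_upperQuantizationDim hb⟩
  have h := upperQuantizationDim_mem_Icc hb hr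
  exact ⟨ne_bot_of_le_ne_bot (by simp) h.1, ne_top_of_le_ne_top (EReal.coe_ne_top _) h.2⟩
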